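/- **Notation.** Below, $\mathcal N(m,s)$ is the normal distribution on $\mathbb R$ with mean $m$ and standard deviation $s\ge 0$ (a point mass if $s=0$). For $\mu,p\in\mathbb R^K$ with $p$ a probability vector, $\mathit{MoG}(\mu,p,\sigma)=\sum_{k=1}^K p_k\,\mathcal N(\mu_k,\sigma)$. For probability measures $P,Q$ and $\alpha\ge 0$, $H_\alpha(P\|Q)=\int\max\{\frac{dP}{dQ}-\alpha,0\}\,dQ+P^{\perp}(\text{whole space})$ is the hockey stick divergence, where $\frac{dP}{dQ}$ is the density of the $Q$-absolutely continuous part and $P^\perp$ the $Q$-singular part of $P$ (zero if $P\ll Q$), and $\mathrm{TVD}(P,Q)=H_1(P\|Q)$. **Data.** A dataset is $x=(x_1,\dots,x_N)$ with $x_n\in\mathbb R^L$. For $v\ge0$, write $x\simeq x'$ ($(1,v)$-event-level neighboring) if $x$ and $x'$ differ in at most one series $x_n$, in there at most at one time step, and by at most $v$ in absolute value. **Mechanism.** Let the context length $L_C$ and the forecast length $L_F$ satisfy $L-L_F+1\ge L_C+L_F$. Let $\lambda,\Lambda\ge1$ be integers with $\lfloor\Lambda/\lambda\rfloor\le N$,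 let $f_\vartheta$ be a model with weights $\vartheta\in\mathbb R^D$ that maps $\mathbb R^{L_C}$ to an arbitrary set, and let $\ell$ be a real-valued loss comparing a model output with an element of $\mathbb R^{L_F}$. Fix current weights $\theta$ and suppose that the gradient $g(c,z)=\nabla_\theta\,\ell(f_\theta(c),z)$ (set to $0$ where $\ell(f_\vartheta(c),z)$ is not differentiable in $\vartheta$ at $\theta$) is a measurable function of $(c,z)\in\mathbb R^{L_C}\times\mathbb R^{L_F}$. Let $\eta\in\mathbb R$, $\sigma,\sigma_C,\sigma_F\ge0$ and $C>0$. Let $\hat M_x$ be the distribution of the output of the following training step on $x$. 1. Draw a uniformly random permutation $\pi$ of $\{1,\dots,N\}$ and select the series $x_{\pi(1)},\dots,x_{\pi(N')}$ with $N'=\lfloor\Lambda/\lambda\rfloor$. 2. For each selected series, prepend $L_C$ zeros and, $\lambda$ times independently, draw $t$ uniformly from $\{1,\dots,L-L_F+1\}$ and take the entries at positions $t,\dots,t+L_C+L_F-1$ of the padded series. The result is a subsequence $y_i$, whose first $L_C$ entries form $y_{C,i}$ and whose last $L_F$ entries form $y_{F,i}$. 3. Put $g_i=g(y_{C,i}+Z_{C,i},\,y_{F,i}+Z_{F,i})$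 with fresh independent noise $Z_{C,i}\sim\mathcal N(0,\sigma_C^2v^2I)$ and $Z_{F,i}\sim\mathcal N(0,\sigma_F^2v^2I)$. 4. Return $\theta-\eta\cdot\frac1\Lambda\Big(\sum_i g_i/\max\{1,\|g_i\|_2/C\}+Z\Big)$ with independent $Z\sim\mathcal N(0,\sigma^2C^2I)$ in $\mathbb R^D$. **Theorem.** Let $\lambda=1$ and $\sigma_C=\sigma_F$. Put $r=\frac{L_C+L_F}{L-L_F+1}$, $\rho=\lfloor\Lambda/\lambda\rfloor/N$, and $$p_2=\rho\cdot r\cdot\mathrm{TVD}\big(\mathcal N(0,\sigma_F),\mathcal N(1,\sigma_F)\big),\qquad p_1=1-p_2 .$$ Then $p_1,p_2\in[0,1]$. With $\hat P=\mathit{MoG}\big((0,2),(p_1,p_2),\sigma\big)$, the per-step privacy profile $\hat H(\alpha)=\sup_{x\simeq x'}H_\alpha(\hat M_x\|\hat M_{x'})$ satisfies $$\hat H(\alpha)\le\begin{cases}H_\alpha\big(\hat P\,\|\,\mathcal N(0,\sigma)\big)&\text{if }\alpha\ge1,\\ H_\alpha\big(\mathcal N(0,\sigma)\,\|\,\hat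 P\big)&\text{if }0\le\alpha<1.\end{cases}$$ -/

import Mathlib

open MeasureTheory ProbabilityTheory
open scoped NNReal ENNReal

namespace DPForecast

noncomputable section

/-! ### Divergences and Gaussian mixtures -/

/-- Hockey stick divergence `H_α(P ‖ Q) = ∫ max (dP/dQ - α, 0) dQ`, with `dP/dQ = ∞` on the part
of the space that carries the `Q`-singular part of `P` (whence the second summand, which vanishes
if `P ≪ Q`). The subtraction in `ℝ≥0∞` is truncated at `0`. -/
def hockeyStick {E : Type*} [MeasurableSpace E] (α : ℝ≥0) (P Q : Measure E) : ℝ≥0∞ :=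
  (∫⁻ o, (P.rnDeriv Q o - (α : ℝ≥0∞)) ∂Q) + P.singularPart Q Set.univ

/-- Total variation distance, `TVD(P, Q) = H_1(P ‖ Q)`. -/
def tvd {E : Type*} [MeasurableSpace E] (P Q : Measure E) : ℝ :=
  (hockeyStick 1 P Q).toReal

/-- The univariate normal distribution with mean `m` and standard deviation `|s|`
(a point mass if `s = 0`). -/
def normal (m s : ℝ) : Measure ℝ := gaussianReal m (s ^ 2).toNNReal

/-- The mixture of Gaussians `∑ k, p k • 𝒩(μ k, σ)`. -/
def mog {K : ℕ} (μ p : Fin K → ℝ) (σ : ℝ) : Measure ℝ :=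
  ∑ k, ENNReal.ofReal (p k) • normal (μ k) σ

/-- The mixture of the finitely many measures `μ i` with equal weights. -/
def uniformMixture {ι E : Type*} [Fintype ι] [MeasurableSpace E] (μ : ι → Measure E) :
    Measure E :=
  (Fintype.card ι : ℝ≥0∞)⁻¹ • ∑ i, μ i

/-! ### Datasets of time series and their neighboring relation -/

/-- Two datasets of `N` series of length `L` are `(w, v)`-event-level neighboring: they differ in
at most one series, there only within a range of `w` consecutive time steps, and by at most `v`
at each step. -/
def EventNeighbor {N L : ℕ} (w : ℕ) (v : ℝ) (x x' : Fin N → Fin L → ℝ) : Prop :=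
  ∃ n : Fin N, (∀ m, m ≠ n → x m = x' m) ∧
    (∃ t : ℕ, ∀ s : Fin L, x n s ≠ x' n s → t ≤ s ∧ (s : ℕ) < t + w) ∧
    ∀ s : Fin L, |x n s - x' n s| ≤ v

/-! ### Subsequences -/

/-- The subsequence of length `LC + LF` that starts at (zero-based) position `t` of the series `a`
with `LC` zeros prepended. There are `L - LF + 1` possible start positions. -/
def subsequence {L : ℕ} (LC LF : ℕ) (a : Fin L → ℝ) (t : Fin (L + 1 - LF)) :
    Fin (LC + LF) → ℝ :=
  fun k => Fin.append (0 : Fin LC → ℝ) a ⟨t + k, by omega⟩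

/-- The first `LC` entries. -/
def contextWindow {LC LF : ℕ} (y : Fin (LC + LF) → ℝ) : Fin LC → ℝ :=
  fun k => y (Fin.castAdd LF k)

/-- The last `LF` entries. -/
def forecastWindow {LC LF : ℕ} (y : Fin (LC + LF) → ℝ) : Fin LF → ℝ :=
  fun k => y (Fin.natAdd LC k)

/-! ### The training step -/

/-- The gradient `∇_θ ℓ(f_θ(c), z)` of the loss with respect to the weights
(`0` if the loss is not differentiable there). -/
def lossGradient {LC LF D : ℕ} {O : Type*} (f : EuclideanSpace ℝ (Fin D) → (Fin LC → ℝ) → O)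
    (ℓ : O → (Fin LF → ℝ) → ℝ) (θ : EuclideanSpace ℝ (Fin D))
    (c : Fin LC → ℝ) (z : Fin LF → ℝ) : EuclideanSpace ℝ (Fin D) :=
  gradient (fun ϑ => ℓ (f ϑ c) z) θ

/-- Clipping to norm `C`, that is, `g / max {1, ‖g‖ / C}`. -/
def clip {D : ℕ} (C : ℝ) (g : EuclideanSpace ℝ (Fin D)) : EuclideanSpace ℝ (Fin D) :=
  (max 1 (‖g‖ / C))⁻¹ • g

/-- The updated weights after one step, given the batch `y` (with `lam` subsequences from each of
`N'` series), the noise `zC`, `zF` added to the context and forecast windows, and the noise `z`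
added to the sum of clipped gradients. -/
def trainingStep {LC LF D N' lam : ℕ} {O : Type*} (Λ : ℕ)
    (f : EuclideanSpace ℝ (Fin D) → (Fin LC → ℝ) → O) (ℓ : O → (Fin LF → ℝ) → ℝ)
    (θ : EuclideanSpace ℝ (Fin D)) (η C : ℝ)
    (y : Fin N' → Fin lam → Fin (LC + LF) → ℝ)
    (zC : Fin N' → Fin lam → Fin LC → ℝ) (zF : Fin N' → Fin lam → Fin LF → ℝ)
    (z : Fin D → ℝ) : EuclideanSpace ℝ (Fin D) :=
  θ - η • ((1 / (Λ : ℝ)) •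
    ((∑ n, ∑ j, clip C (lossGradient f ℓ θ
        (contextWindow (y n j) + zC n j) (forecastWindow (y n j) + zF n j)))
      + WithLp.toLp 2 z))

/-- The output distribution on dataset `x` of a single training step with
* top-level sampling without replacement: the first `⌊Λ / lam⌋` series after a uniformly random
  permutation `π`;
* bottom-level sampling with replacement: `lam` independent uniformly random start positions
  `t n j` for each selected series;
* independent Gaussian noise with standard deviations `σC * v` and `σF * v` added to each entry of
  each context and forecast window;
* independent Gaussian noise with standard deviation `σ * C` added to each coordinate of the sum
  of clipped gradients. -/
def stepLaw {L LC LF D N : ℕ} {O : Type*} (lam Λ : ℕ) (hN : Λ / lam ≤ N)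
    (f : EuclideanSpace ℝ (Fin D) → (Fin LC → ℝ) → O) (ℓ : O → (Fin LF → ℝ) → ℝ)
    (θ : EuclideanSpace ℝ (Fin D)) (η σ C σC σF v : ℝ)
    (x : Fin N → Fin L → ℝ) : Measure (EuclideanSpace ℝ (Fin D)) :=
  uniformMixture
    fun ω : Equiv.Perm (Fin N) × (Fin (Λ / lam) → Fin lam → Fin (L + 1 - LF)) =>
      Measure.map
        (fun Z : (Fin (Λ / lam) → Fin lam → Fin LC → ℝ) ×
            (Fin (Λ / lam) → Fin lam → Fin LF → ℝ) × (Fin D → ℝ) =>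
          trainingStep Λ f ℓ θ η C
            (fun n j => subsequence LC LF (x (ω.1 (Fin.castLE hN n))) (ω.2 n j))
            Z.1 Z.2.1 Z.2.2)
        ((Measure.pi fun _ => Measure.pi fun _ => Measure.pi fun _ => normal 0 (σC * v)).prod
          ((Measure.pi fun _ => Measure.pi fun _ => Measure.pi fun _ => normal 0 (σF * v)).prod
            (Measure.pi fun _ => normal 0 (σ * C))))

end

end DPForecast

open DPForecast

/-!
The hockey stick divergence `H_a(P ‖ Q)` is the least `h` with `P S ≤ a * Q S + h` for all events
`S`, so the divergences are bounded one event at a time. A modified entry occurs in at most `LC`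
context windows and `LF` forecast windows, so the perturbed subsequence drawn from a modified series
moves by at most `δ = subsequenceTVD` in total variation. Permutations that sample the modified
series are paired with those that do not by exchanging its position with one outside the sample;
replacing a single contribution moves the sum of clipped gradients by at most `2 * C`. Hence the two
outputs are no easier to tell apart than Gaussian noise of scale `σ` that is shifted by `2` with
probability `ρ * δ` from noise that never is.
-/

namespace DPForecast

/-! ### Test bounds -/

section TestBound

/-- A bound on the power of tests `S` between `P` and `Q`. For `k = 1` the least possible `h` is the
hockey stick divergence `H_a(P ‖ Q)`; weighting both measures makes the notion stable under
exchanging `P` and `Q`, see `TestBound.swap`. -/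
def TestBound {E : Type*} [MeasurableSpace E] (k a : ℝ≥0) (h : ℝ≥0∞) (P Q : Measure E) : Prop :=
  ∀ S, MeasurableSet S → k * P S ≤ a * Q S + h

variable {E F : Type*} [MeasurableSpace E] [MeasurableSpace F] {k a : ℝ≥0} {h h' : ℝ≥0∞}
  {P Q : Measure E}

lemma TestBound.refl (hka : k ≤ a) (h : ℝ≥0∞) (P : Measure E) : TestBound k a h P P :=
  fun _ _ => le_add_right (mul_le_mul_left (ENNReal.coe_le_coe.mpr hka) _)

lemma TestBound.mono (H : TestBound k a h P Q) (hh : h ≤ h') : TestBound k a h' P Q :=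
  fun S hS => (H S hS).trans (add_le_add_right hh _)

lemma TestBound.map (H : TestBound k a h P Q) {g : E → F} (hg : Measurable g) :
    TestBound k a h (P.map g) (Q.map g) := fun S hS => by
  simpa only [Measure.map_apply hg hS] using H _ (hg hS)

lemma TestBound.prod_right [SFinite P] [SFinite Q] (H : TestBound k a h P Q)
    (ρ : Measure F) [IsProbabilityMeasure ρ] : TestBound k a h (P.prod ρ) (Q.prod ρ) :=
  fun S hS => by
  have hmeas (P : Measure E) [SFinite P] : Measurable fun y => P ((fun x => (x, y)) ⁻¹' S) :=
    measurable_measure_prodMk_right hS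
  calc k * P.prod ρ S
      = ∫⁻ y, k * P ((fun x => (x, y)) ⁻¹' S) ∂ρ := by
        rw [Measure.prod_apply_symm hS, lintegral_const_mul _ (hmeas P)]
    _ ≤ ∫⁻ y, (a * Q ((fun x => (x, y)) ⁻¹' S) + h) ∂ρ :=
        lintegral_mono fun y => H _ (measurable_prodMk_right hS)
    _ = a * Q.prod ρ S + h := by
        rw [lintegral_add_right _ measurable_const, lintegral_const_mul _ (hmeas Q),
          lintegral_const, measure_univ, mul_one, Measure.prod_apply_symm hS]

lemma TestBound.prod_left [SFinite P] [SFinite Q] (H : TestBound k a h P Q)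
    (ρ : Measure F) [IsProbabilityMeasure ρ] : TestBound k a h (ρ.prod P) (ρ.prod Q) := by
  simpa only [Measure.prod_swap] using (H.prod_right ρ).map measurable_swap

lemma TestBound.swap [IsProbabilityMeasure P] [IsProbabilityMeasure Q]
    (H : TestBound k a h P Q) (hh : h' + k = h + a) : TestBound a k h' Q P := fun S hS => by
  refine (ENNReal.add_le_add_iff_right (ENNReal.coe_ne_top (r := k))).mp ?_
  calc a * Q S + k
      = a * Q S + k * P S + k * P Sᶜ := by
        rw [add_assoc, ← mul_add, prob_add_prob_compl hS, mul_one]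
    _ ≤ a * Q S + k * P S + (a * Q Sᶜ + h) := by gcongr; exact H _ hS.compl
    _ = k * P S + (h + a * (Q S + Q Sᶜ)) := by ring
    _ = k * P S + h' + k := by rw [prob_add_prob_compl hS, mul_one, ← hh, add_assoc]

lemma TestBound.of_mixture {b p q : ℝ≥0} {R : Measure E} [IsFiniteMeasure Q]
    (H : TestBound k (b + k * q) h ((q : ℝ≥0∞) • Q + (p : ℝ≥0∞) • R) Q) :
    TestBound (k * p) b h R Q := fun S hS => by
  have hfin : k * q * Q S ≠ ∞ := by finiteness
  refine (ENNReal.add_le_add_iff_left hfin).mp ?_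
  calc k * q * Q S + (k * p : ℝ≥0) * R S
      = k * ((q : ℝ≥0∞) • Q + (p : ℝ≥0∞) • R) S := by
        simp only [Measure.add_apply, Measure.smul_apply, smul_eq_mul, ENNReal.coe_mul]; ring
    _ ≤ (b + k * q : ℝ≥0) * Q S + h := H S hS
    _ = k * q * Q S + (b * Q S + h) := by push_cast; ring

lemma pi_map_update {ι X : Type*} [Fintype ι] [DecidableEq ι] [MeasurableSpace X]
    {μ ν : ι → Measure X} [∀ i, IsProbabilityMeasure (μ i)] [∀ i, IsProbabilityMeasure (ν i)]
    (n : ι) (hne : ∀ i, i ≠ n → μ i = ν i) :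
    ((ν n).prod (Measure.pi μ)).map (fun q => Function.update q.2 n q.1) = Measure.pi ν := by
  refine (Measure.pi_eq fun s hs => ?_).symm
  have hpre : (fun q : X × (ι → X) => Function.update q.2 n q.1) ⁻¹' Set.univ.pi s =
      s n ×ˢ Set.univ.pi (Function.update s n Set.univ) := by
    ext q
    simp only [Set.mem_preimage, Set.mem_pi, Set.mem_univ, true_imp_iff, Set.mem_prod]
    refine ⟨fun H => ⟨by simpa using H n, fun i => ?_⟩, fun H i => ?_⟩ <;>
      rcases eq_or_ne i n with rfl | hi
    · simp
    · simpa [hi] using H i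
    · simpa using H.1
    · simpa [hi] using H.2 i
  rw [Measure.map_apply (by fun_prop) (.univ_pi hs), hpre, Measure.prod_prod, Measure.pi_pi,
    ← Finset.mul_prod_erase _ _ (Finset.mem_univ n),
    ← Finset.mul_prod_erase _ (fun i => ν i (s i)) (Finset.mem_univ n), Function.update_self,
    measure_univ, one_mul]
  congr 1
  refine Finset.prod_congr rfl fun i hi => ?_
  rw [Function.update_of_ne (Finset.ne_of_mem_erase hi), hne i (Finset.ne_of_mem_erase hi)]

lemma TestBound.pi {ι X : Type*} [Fintype ι] [MeasurableSpace X]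
    {μ ν : ι → Measure X} [∀ i, IsProbabilityMeasure (μ i)] [∀ i, IsProbabilityMeasure (ν i)]
    (n : ι) (H : TestBound k a h (μ n) (ν n)) (hne : ∀ i, i ≠ n → μ i = ν i) :
    TestBound k a h (Measure.pi μ) (Measure.pi ν) := by
  classical
  rw [← pi_map_update (μ := μ) n fun _ _ => rfl, ← pi_map_update n hne]
  exact (H.prod_right _).map (by fun_prop)

lemma testBound_hockeyStick (a : ℝ≥0) (P Q : Measure E) [IsFiniteMeasure P] [IsFiniteMeasure Q] :
    TestBound 1 a (hockeyStick a P Q) P Q := fun S hS => by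
  calc ((1 : ℝ≥0) : ℝ≥0∞) * P S
      = P.singularPart Q S + ∫⁻ o in S, P.rnDeriv Q o ∂Q := by
        conv_lhs => rw [← Measure.singularPart_add_rnDeriv P Q]
        rw [ENNReal.coe_one, one_mul, Measure.add_apply, withDensity_apply _ hS]
    _ ≤ P.singularPart Q Set.univ + ∫⁻ o in S, (a + (P.rnDeriv Q o - a)) ∂Q :=
        add_le_add (measure_mono (Set.subset_univ _)) (lintegral_mono fun o => le_add_tsub)
    _ ≤ P.singularPart Q Set.univ + (a * Q S + ∫⁻ o, (P.rnDeriv Q o - a) ∂Q) := by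
        rw [lintegral_add_left measurable_const, setLIntegral_const]
        gcongr
        exact Measure.restrict_le_self
    _ = a * Q S + hockeyStick a P Q := by rw [hockeyStick]; ring

lemma lintegral_tsub_const_add {μ : Measure E} {f : E → ℝ≥0∞} (hf : Measurable f) (c : ℝ≥0∞) :
    ∫⁻ o, (f o - c) ∂μ + c * μ {o | c < f o} = ∫⁻ o in {o | c < f o}, f o ∂μ := by
  have hB : MeasurableSet {o | c < f o} := measurableSet_lt measurable_const hf
  have hsupp : ∫⁻ o in {o | c < f o}, (f o - c) ∂μ = ∫⁻ o, (f o - c) ∂μ :=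
    setLIntegral_eq_of_support_subset fun o ho => tsub_pos_iff_lt.mp (pos_iff_ne_zero.mpr ho)
  rw [← hsupp, ← setLIntegral_const, ← lintegral_add_right _ measurable_const]
  exact setLIntegral_congr_fun hB fun o ho => tsub_add_cancel_of_le (le_of_lt ho)

lemma exists_hockeyStick_add_eq (a : ℝ≥0) (P Q : Measure E) [IsFiniteMeasure P]
    [IsFiniteMeasure Q] :
    ∃ S, MeasurableSet S ∧ hockeyStick a P Q + a * Q S = P S := by
  obtain ⟨s, hs, hsing, hQs⟩ := Measure.mutuallySingular_singularPart P Q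
  set B : Set E := {o | (a : ℝ≥0∞) < P.rnDeriv Q o}
  have hB : MeasurableSet B := measurableSet_lt measurable_const (Measure.measurable_rnDeriv P Q)
  have hS : MeasurableSet (sᶜ ∪ B) := hs.compl.union hB
  have hae : (sᶜ ∪ B : Set E) =ᵐ[Q] B := union_ae_eq_right_of_ae_eq_empty (ae_eq_empty.mpr hQs)
  have hSsing : P.singularPart Q (sᶜ ∪ B) = P.singularPart Q Set.univ :=
    measure_congr (ae_eq_univ.mpr (measure_mono_null (by simp) hsing))
  refine ⟨sᶜ ∪ B, hS, ?_⟩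
  calc hockeyStick a P Q + a * Q (sᶜ ∪ B)
      = P.singularPart Q Set.univ + (∫⁻ o, (P.rnDeriv Q o - a) ∂Q + a * Q B) := by
        rw [measure_congr hae, hockeyStick]; ring
    _ = P.singularPart Q (sᶜ ∪ B) + ∫⁻ o in sᶜ ∪ B, P.rnDeriv Q o ∂Q := by
        rw [lintegral_tsub_const_add (Measure.measurable_rnDeriv P Q), hSsing,
          setLIntegral_congr hae]
    _ = P (sᶜ ∪ B) := by
        conv_rhs => rw [← Measure.singularPart_add_rnDeriv P Q]
        rw [Measure.add_apply, withDensity_apply _ hS]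

lemma TestBound.hockeyStick_le [IsFiniteMeasure P] [IsFiniteMeasure Q]
    (H : TestBound 1 a h P Q) : hockeyStick a P Q ≤ h := by
  obtain ⟨S, hS, hopt⟩ := exists_hockeyStick_add_eq a P Q
  have hfin : a * Q S ≠ ∞ := by finiteness
  refine (ENNReal.add_le_add_iff_right hfin).mp ?_
  simpa only [hopt, ENNReal.coe_one, one_mul, add_comm h] using H S hS

lemma hockeyStick_le_one (a : ℝ≥0) (P Q : Measure E) [IsProbabilityMeasure P]
    [IsFiniteMeasure Q] : hockeyStick a P Q ≤ 1 :=
  TestBound.hockeyStick_le fun S _ => by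
    simpa only [ENNReal.coe_one, one_mul] using le_add_left prob_le_one

lemma one_le_hockeyStick_add (a : ℝ≥0) (P Q : Measure E) [IsProbabilityMeasure P]
    [IsProbabilityMeasure Q] : 1 ≤ hockeyStick a P Q + a := by
  simpa [add_comm] using testBound_hockeyStick a P Q Set.univ .univ

lemma hockeyStick_le_of_testBound_imp {P' Q' : Measure F} [IsProbabilityMeasure P]
    [IsProbabilityMeasure Q] [IsProbabilityMeasure P'] [IsProbabilityMeasure Q']
    (H : ∀ h, TestBound a 1 h P Q → TestBound a 1 h P' Q') :
    hockeyStick a Q' P' ≤ hockeyStick a Q P := by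
  obtain ⟨h', hh'⟩ := exists_add_of_le (one_le_hockeyStick_add a Q P)
  have hswap : h' + (1 : ℝ≥0) = hockeyStick a Q P + a := by rw [hh', add_comm, ENNReal.coe_one]
  exact ((H h' ((testBound_hockeyStick a Q P).swap hswap)).swap hswap.symm).hockeyStick_le

lemma tvd_nonneg (P Q : Measure E) : 0 ≤ tvd P Q := ENNReal.toReal_nonneg

lemma tvd_le_one (P Q : Measure E) [IsProbabilityMeasure P] [IsFiniteMeasure Q] : tvd P Q ≤ 1 :=
  ENNReal.toReal_le_of_le_ofReal zero_le_one (by simpa using hockeyStick_le_one 1 P Q)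

lemma testBound_tvd_swap (P Q : Measure E) [IsProbabilityMeasure P] [IsProbabilityMeasure Q] :
    TestBound 1 1 (ENNReal.ofReal (tvd P Q)) Q P := by
  rw [tvd, ENNReal.ofReal_toReal (ne_top_of_le_ne_top ENNReal.one_ne_top
    (hockeyStick_le_one 1 P Q))]
  exact (testBound_hockeyStick 1 P Q).swap rfl

lemma lintegral_add_lintegral_le {μ ν : Measure E} [IsFiniteMeasure μ] (hμν : μ ≤ ν)
    {f g : E → ℝ≥0∞} (hfg : f ≤ g) :
    ∫⁻ e, g e ∂μ + ∫⁻ e, f e ∂ν ≤ ∫⁻ e, f e ∂μ + ∫⁻ e, g e ∂ν := by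
  rw [← Measure.sub_add_cancel_of_le hμν, lintegral_add_measure, lintegral_add_measure]
  calc ∫⁻ e, g e ∂μ + (∫⁻ e, f e ∂(ν - μ) + ∫⁻ e, f e ∂μ)
      = ∫⁻ e, f e ∂μ + (∫⁻ e, f e ∂(ν - μ) + ∫⁻ e, g e ∂μ) := by ring
    _ ≤ ∫⁻ e, f e ∂μ + (∫⁻ e, g e ∂(ν - μ) + ∫⁻ e, g e ∂μ) := by gcongr; exact hfg _

lemma TestBound.lintegral_le [IsProbabilityMeasure P] [IsProbabilityMeasure Q]
    (H : TestBound 1 1 h P Q) {ψ : E → ℝ≥0∞} {m w : ℝ≥0∞} (hm : m ≠ ∞) (hw : w ≠ ∞)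
    (hmψ : ∀ e, m ≤ ψ e) (hψ : ∀ e, ψ e ≤ m + w) :
    ∫⁻ e, ψ e ∂P ≤ ∫⁻ e, ψ e ∂Q + h * w := by
  obtain ⟨s, hs, hQP, hPQ⟩ := exists_isHahnDecomposition Q P
  have hon := lintegral_add_lintegral_le hQP (f := ψ) (g := fun _ => m + w) hψ
  have hoff := lintegral_add_lintegral_le hPQ (f := fun _ => m) (g := ψ) hmψ
  simp only [lintegral_const, Measure.restrict_apply_univ] at hon hoff
  have hsplit (R : Measure E) [IsProbabilityMeasure R] : m * R s + m * R sᶜ = m := by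
    rw [← mul_add, prob_add_prob_compl hs, mul_one]
  have hfin : m + w * Q s ≠ ∞ := by finiteness
  refine (ENNReal.add_le_add_iff_right hfin).mp ?_
  calc ∫⁻ e, ψ e ∂P + (m + w * Q s)
      = ((m + w) * Q s + ∫⁻ e in s, ψ e ∂P) + (∫⁻ e in sᶜ, ψ e ∂P + m * Q sᶜ) := by
        conv_lhs => rw [← lintegral_add_compl ψ hs, ← hsplit Q]
        ring
    _ ≤ (∫⁻ e in s, ψ e ∂Q + (m + w) * P s) + (m * P sᶜ + ∫⁻ e in sᶜ, ψ e ∂Q) := by gcongr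
    _ = ∫⁻ e, ψ e ∂Q + (m + w * P s) := by
        conv_rhs => rw [← lintegral_add_compl ψ hs, ← hsplit P]
        ring
    _ ≤ ∫⁻ e, ψ e ∂Q + (m + w * (Q s + h)) := by
        gcongr; simpa only [ENNReal.coe_one, one_mul] using H s hs
    _ = ∫⁻ e, ψ e ∂Q + h * w + (m + w * Q s) := by ring

end TestBound

/-! ### Gaussian noise -/

section Gaussian

instance (m s : ℝ) : IsProbabilityMeasure (normal m s) := by
  unfold normal; infer_instance

lemma normal_map_const_mul (c m s : ℝ) : (normal m s).map (c * ·) = normal (c * m) (c * s) := by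
  rw [normal, normal, gaussianReal_map_const_mul]
  congr 1
  ext
  simp [mul_pow, sq_nonneg, mul_nonneg]

lemma normal_map_const_add (c m s : ℝ) : (normal m s).map (c + ·) = normal (c + m) s := by
  rw [normal, normal, gaussianReal_map_const_add, add_comm]

lemma normal_conv_normal (m m' s s' : ℝ) :
    (normal m s).conv (normal m' s') = normal (m + m') √(s ^ 2 + s' ^ 2) := by
  rw [normal, normal, gaussianReal_conv_gaussianReal, normal, Real.sq_sqrt (by positivity),
    Real.toNNReal_add (sq_nonneg _) (sq_nonneg _)]

lemma normal_abs (m s : ℝ) : normal m |s| = normal m s := by rw [normal, normal, sq_abs]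

lemma pi_normal_map_add {ι : Type*} [Fintype ι] (m b : ι → ℝ) (s : ℝ) :
    (Measure.pi fun i => normal (b i) s).map (fun z i => m i + z i) =
      Measure.pi fun i => normal (m i + b i) s := by
  rw [Measure.pi_map_pi (f := fun i x => m i + x) fun i => (measurable_const_add _).aemeasurable]
  simp_rw [normal_map_const_add]

lemma pi_normal_zero_eq_map (ι : Type*) [Fintype ι] (s : ℝ) :
    (Measure.pi fun _ : ι => normal 0 s) = (Measure.pi fun _ => gaussianReal 0 1).map (s • ·) := by
  have hstd : gaussianReal 0 1 = normal 0 1 := by simp [normal]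
  have hmap := Measure.pi_map_pi (μ := fun _ : ι => normal 0 1) (f := fun _ x => s * x)
    fun _ => (measurable_const_mul _).aemeasurable
  simp only [normal_map_const_mul, mul_zero, mul_one] at hmap
  rw [← hmap, hstd]
  rfl

lemma pi_normal_map_toLp {ι κ : Type*} [Fintype ι] [Fintype κ]
    (b : OrthonormalBasis ι ℝ (EuclideanSpace ℝ κ)) (s : ℝ) :
    (Measure.pi fun _ => normal 0 s).map (WithLp.toLp 2) =
      (Measure.pi fun _ => normal 0 s).map fun z : ι → ℝ => ∑ i, z i • b i := by
  have hstd := congrArg (Measure.map (s • ·))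
    (map_pi_eq_stdGaussian.trans (stdGaussian_eq_map_pi_orthonormalBasis b))
  rw [Measure.map_map (by fun_prop) (by fun_prop), Measure.map_map (by fun_prop) (by fun_prop)]
    at hstd
  rw [pi_normal_zero_eq_map, pi_normal_zero_eq_map, Measure.map_map (by fun_prop) (by fun_prop),
    Measure.map_map (by fun_prop) (by fun_prop)]
  convert hstd using 2
  · rfl
  · ext1 z
    simp [Finset.smul_sum, smul_smul]

variable {k a : ℝ≥0} {h : ℝ≥0∞}

/- The coarser distributions arise from the finer ones by rescaling and adding independent noise,
so no likelihood ratio has to be computed. -/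
lemma TestBound.normal_contract {m m' s t c : ℝ} (H : TestBound k a h (normal m s) (normal m' s))
    (ht : |t| ≤ c) (b : ℝ) :
    TestBound k a h (normal (b + t * m) (c * s)) (normal (b + t * m') (c * s)) := by
  have hpost (m : ℝ) : normal (b + t * m) (c * s) =
      (((normal m s).map (t * ·)).map (b + ·)).conv (normal 0 (√(c ^ 2 - t ^ 2) * s)) := by
    have hvar : (t * s) ^ 2 + (√(c ^ 2 - t ^ 2) * s) ^ 2 = (c * s) ^ 2 := by
      rw [mul_pow, mul_pow, Real.sq_sqrt (sub_nonneg.mpr (sq_le_sq.mpr (ht.trans (le_abs_self c))))]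
      ring
    rw [normal_map_const_mul, normal_map_const_add, normal_conv_normal, hvar, add_zero,
      Real.sqrt_sq_eq_abs, normal_abs]
  rw [hpost, hpost]
  exact (((H.map (measurable_const_mul t)).map (measurable_const_add b)).prod_right _).map
    measurable_add

lemma TestBound.gaussian_translate {κ : Type*} [Fintype κ] {d s : ℝ}
    (H : TestBound k a h (normal d s) (normal 0 s)) (u : EuclideanSpace ℝ κ)
    {e : EuclideanSpace ℝ κ} (he : ‖e‖ = 1) :
    TestBound k a h
      ((Measure.pi fun _ => normal 0 s).map fun z : κ → ℝ => u + d • e + WithLp.toLp 2 z)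
      ((Measure.pi fun _ => normal 0 s).map fun z : κ → ℝ => u + WithLp.toLp 2 z) := by
  classical
  obtain ⟨ι, b, heι, hb⟩ := Orthonormal.exists_orthonormalBasis_extension (𝕜 := ℝ) (v := {e})
    (orthonormal_subsingleton_iff.mpr fun i => by rw [i.2, he])
  let i₀ : ι := ⟨e, heι rfl⟩
  have hbasis (v : EuclideanSpace ℝ κ) :
      (Measure.pi fun _ => normal 0 s).map (fun z : κ → ℝ => v + WithLp.toLp 2 z) =
        (Measure.pi fun _ => normal 0 s).map fun z : ι → ℝ => v + ∑ i, z i • b i := by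
    have := congrArg (Measure.map (v + ·)) (pi_normal_map_toLp b s)
    rwa [Measure.map_map (by fun_prop) (by fun_prop),
      Measure.map_map (by fun_prop) (by fun_prop)] at this
  have hshift : (Measure.pi fun _ => normal 0 s).map (fun z => u + d • e + ∑ i, z i • b i) =
      (Measure.pi fun i => normal (Pi.single (M := fun _ => ℝ) i₀ d i) s).map
        fun z => u + ∑ i, z i • b i := by
    have hmean : ∑ i, Pi.single (M := fun _ => ℝ) i₀ d i • b i = d • e := by
      rw [Finset.sum_eq_single i₀ (fun i _ hi => by simp [hi]) (by simp), hb, Pi.single_eq_same]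
    have hadd := pi_normal_map_add (Pi.single (M := fun _ => ℝ) i₀ d) 0 s
    simp only [Pi.zero_apply, add_zero] at hadd
    rw [← hadd, Measure.map_map (by fun_prop) (by fun_prop)]
    congr 1
    ext1 z
    simp only [Function.comp_apply, add_smul, Finset.sum_add_distrib, hmean, add_assoc]
  rw [hbasis, hbasis, hshift]
  refine TestBound.map (TestBound.pi i₀ ?_ fun i hi => by simp [hi]) (by fun_prop)
  simpa using H

lemma TestBound.gaussian_of_norm_sub_le {κ : Type*} [Fintype κ] {s m' c : ℝ} (hka : k ≤ a)
    (H : TestBound k a h (normal m' s) (normal 0 s)) (hm' : 0 < m') {w u : EuclideanSpace ℝ κ}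
    (hwu : ‖w - u‖ ≤ c * m') :
    TestBound k a h
      ((Measure.pi fun _ => normal 0 (c * s)).map fun z : κ → ℝ => w + WithLp.toLp 2 z)
      ((Measure.pi fun _ => normal 0 (c * s)).map fun z : κ → ℝ => u + WithLp.toLp 2 z) := by
  rcases eq_or_ne w u with rfl | hne
  · exact .refl hka _ _
  have hpos : 0 < ‖w - u‖ := norm_pos_iff.mpr (sub_ne_zero.mpr hne)
  have hd := H.normal_contract (t := ‖w - u‖ / m')
    (by rwa [abs_of_pos (by positivity), div_le_iff₀ hm']) 0
  rw [div_mul_cancel₀ _ hm'.ne', mul_zero, add_zero, zero_add] at hd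
  have := hd.gaussian_translate u (e := ‖w - u‖⁻¹ • (w - u))
    (by rw [norm_smul, norm_inv, norm_norm, inv_mul_cancel₀ hpos.ne'])
  rwa [smul_inv_smul₀ hpos.ne', add_sub_cancel] at this

end Gaussian

/-! ### Uniform mixtures -/

section UniformMixture

variable {ι E F : Type*} [Fintype ι] [MeasurableSpace E] [MeasurableSpace F]

lemma uniformMixture_apply (μ : ι → Measure E) (S : Set E) :
    uniformMixture μ S = (Fintype.card ι : ℝ≥0∞)⁻¹ * ∑ i, μ i S := by
  simp [uniformMixture]

instance [Nonempty ι] (μ : ι → Measure E) [∀ i, IsProbabilityMeasure (μ i)] :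
    IsProbabilityMeasure (uniformMixture μ) :=
  ⟨by simp [uniformMixture_apply, ENNReal.inv_mul_cancel]⟩

lemma lintegral_uniformMixture (μ : ι → Measure E) (f : E → ℝ≥0∞) :
    ∫⁻ e, f e ∂uniformMixture μ = (Fintype.card ι : ℝ≥0∞)⁻¹ * ∑ i, ∫⁻ e, f e ∂μ i := by
  rw [uniformMixture, lintegral_smul_measure, lintegral_finsetSum_measure, smul_eq_mul]

lemma uniformMixture_map (μ : ι → Measure E) {f : E → F} (hf : Measurable f) :
    (uniformMixture μ).map f = uniformMixture fun i => (μ i).map f := by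
  ext S hS
  simp [Measure.map_apply hf hS, uniformMixture_apply]

lemma uniformMixture_prod (μ : ι → Measure E) (ν : Measure F) [SFinite ν] :
    (uniformMixture μ).prod ν = uniformMixture fun i => (μ i).prod ν := by
  rw [uniformMixture, uniformMixture, Measure.prod_smul_left, ← Measure.sum_fintype,
    Measure.prod_sum_left, Measure.sum_fintype]

lemma uniformMixture_fst_snd {κ : Type*} [Fintype κ] (μ : ι × κ → Measure E) :
    uniformMixture μ = uniformMixture fun i => uniformMixture fun j => μ (i, j) := by
  ext S _
  simp only [uniformMixture_apply, Fintype.card_prod, Fintype.sum_prod_type, Finset.mul_sum]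
  rw [Nat.cast_mul, ENNReal.mul_inv (by simp) (by simp)]
  simp only [mul_assoc]

lemma pi_uniformMixture {κ : Type*} [Fintype κ] [Nonempty κ] (μ : ι → κ → Measure E)
    [∀ i j, IsProbabilityMeasure (μ i j)] [DecidableEq ι] :
    Measure.pi (fun i => uniformMixture (μ i)) =
      uniformMixture fun t : ι → κ => Measure.pi fun i => μ i (t i) := by
  refine Measure.pi_eq fun s _ => ?_
  simp only [uniformMixture_apply, Measure.pi_pi, Finset.prod_mul_distrib, Finset.prod_univ_sum,
    Fintype.piFinset_univ, Finset.prod_const, Finset.card_univ, Fintype.card_pi]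
  rw [Nat.cast_pow, ENNReal.inv_pow]

lemma TestBound.uniformMixture {k a : ℝ≥0} {h : ι → ℝ≥0∞} {P Q : ι → Measure E}
    (H : ∀ i, TestBound k a (h i) (P i) (Q i)) :
    TestBound k a ((Fintype.card ι : ℝ≥0∞)⁻¹ * ∑ i, h i)
      (uniformMixture P) (uniformMixture Q) := fun S hS => by
  rw [uniformMixture_apply, uniformMixture_apply, mul_left_comm, mul_left_comm (a : ℝ≥0∞),
    ← mul_add, Finset.mul_sum (a := (k : ℝ≥0∞)), Finset.mul_sum (a := (a : ℝ≥0∞)),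
    ← Finset.sum_add_distrib]
  gcongr with i
  exact H i S hS

end UniformMixture

/-! ### Sampling without replacement -/

section Sampling

open Equiv (Perm swap)

lemma update_comp_perm_of_mem
    {X : Type*} {N' m : ℕ} {n : Fin (N' + m)} {j : Fin N'}
    {π : Perm (Fin (N' + m))} (hπ : π (Fin.castAdd m j) = n) (c : Fin (N' + m) → X) (y : X) :
    (fun i => Function.update c n y (π (Fin.castAdd m i))) =
      Function.update (fun i => c (π (Fin.castAdd m i))) j y := by
  rw [← hπ]
  exact Function.update_comp_eq_of_injective c
    (π.injective.comp (Fin.castAdd_injective N' m)) j y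

lemma update_comp_perm_of_exchanged
    {X : Type*} {N' m : ℕ} {n : Fin (N' + m)} {j : Fin N'}
    {π : Perm (Fin (N' + m))} (hπ : π (Fin.castAdd m j) = n) (l : Fin m)
    (c : Fin (N' + m) → X) (y : X) :
    (fun i => Function.update c n y
      ((π * swap (Fin.castAdd m j) (Fin.natAdd N' l)) (Fin.castAdd m i))) =
      Function.update (fun i => c (π (Fin.castAdd m i))) j (c (π (Fin.natAdd N' l))) := by
  have hne (i : Fin N') : Fin.castAdd m i ≠ Fin.natAdd N' l := by
    simp only [ne_eq, Fin.ext_iff, Fin.val_castAdd, Fin.val_natAdd]; omega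
  ext1 i
  rcases eq_or_ne i j with rfl | hij
  · have : π (Fin.natAdd N' l) ≠ n := fun h => hne i (π.injective (hπ.trans h.symm))
    simp [this]
  · have hij' : Fin.castAdd m i ≠ Fin.castAdd m j := (Fin.castAdd_injective N' m).ne hij
    have : π (Fin.castAdd m i) ≠ n := fun h => hij' (π.injective (h.trans hπ.symm))
    simp [this, hij, Equiv.swap_apply_of_ne_of_ne hij' (hne i)]

variable {X : Type*} [MeasurableSpace X]

lemma pi_map_comp_injective {ι κ : Type*} [Fintype ι] [Fintype κ] (μ : ι → Measure X)
    [∀ i, IsProbabilityMeasure (μ i)] {e : κ → ι} (he : e.Injective) :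
    (Measure.pi μ).map (fun c j => c (e j)) = Measure.pi fun j => μ (e j) := by
  have hindep := (iIndepFun_pi (μ := μ) (X := fun _ x => x) fun _ => aemeasurable_id).precomp he
  rw [iIndepFun_iff_map_fun_eq_pi_map fun j => (measurable_pi_apply (e j)).aemeasurable] at hindep
  simpa only [(measurePreserving_eval μ _).map_eq] using hindep

lemma lintegral_pi_comp_eq_lintegral_update {ι κ : Type*} [Fintype ι] [DecidableEq ι] [Fintype κ]
    {μ ν : ι → Measure X} [∀ i, IsProbabilityMeasure (μ i)] [∀ i, IsProbabilityMeasure (ν i)]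
    (n : ι) (hne : ∀ i, i ≠ n → μ i = ν i) {e : κ → ι} (he : e.Injective)
    {Ψ : (κ → X) → ℝ≥0∞} (hΨ : Measurable Ψ) :
    ∫⁻ c, Ψ c ∂(Measure.pi fun j => ν (e j)) =
      ∫⁻ c, ∫⁻ y, Ψ (fun j => Function.update c n y (e j)) ∂ν n ∂Measure.pi μ := by
  have hm : Measurable fun c : ι → X => Ψ fun j => c (e j) := by fun_prop
  rw [← pi_map_comp_injective ν he, lintegral_map hΨ (by fun_prop), ← pi_map_update n hne,
    lintegral_map hm (by fun_prop)]
  exact lintegral_prod_symm' _ (by fun_prop)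

/-- The law of a batch of `N'` contributions when `N` series, whose contributions have the laws
`ν n`, are sampled uniformly without replacement. -/
noncomputable def batchLaw {N N' : ℕ} (hN : N' ≤ N) (ν : Fin N → Measure X) :
    Measure (Fin N' → X) :=
  uniformMixture fun π : Perm (Fin N) => Measure.pi fun i => ν (π (Fin.castLE hN i))

lemma sum_perm_fiber_swap {ι : Type*} [Fintype ι] [DecidableEq ι] (j l n : ι)
    (q : Perm ι → ℝ≥0∞) :
    ∑ π : Perm ι with π l = n, q π = ∑ π : Perm ι with π j = n, q (π * swap j l) := by
  refine Finset.sum_nbij' (· * swap j l) (· * swap j l) ?_ ?_ ?_ ?_ ?_ <;> simp [mul_assoc]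

/-- Permutations that sample `n` at a position `j < N'` are paired with those that do not by
exchanging position `j` with a position outside the sample. -/
lemma sum_perm_exchange {N' m : ℕ} (n : Fin (N' + m)) (q : Perm (Fin (N' + m)) → ℝ≥0∞) :
    N' * ∑ π, q π =
      ∑ j : Fin N', ∑ π : Perm (Fin (N' + m)) with π (Fin.castAdd m j) = n,
        (N' * q π + ∑ l : Fin m, q (π * swap (Fin.castAdd m j) (Fin.natAdd N' l))) := by
  have hfiber : ∑ π, q π = ∑ l, ∑ π : Perm (Fin (N' + m)) with π l = n, q π := by
    rw [← Finset.sum_fiberwise Finset.univ (fun π : Perm _ => π.symm n)]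
    simp only [Equiv.symm_apply_eq, eq_comm (a := n)]
  have hout (j : Fin N') :
      ∑ l : Fin m, ∑ π : Perm (Fin (N' + m)) with π (Fin.natAdd N' l) = n, q π =
      ∑ π : Perm (Fin (N' + m)) with π (Fin.castAdd m j) = n,
        ∑ l : Fin m, q (π * swap (Fin.castAdd m j) (Fin.natAdd N' l)) := by
    rw [Finset.sum_comm]
    exact Finset.sum_congr rfl fun l _ => sum_perm_fiber_swap _ _ _ _
  simp only [Finset.sum_add_distrib, ← hout, Finset.sum_const, Finset.card_univ, Fintype.card_fin,
    nsmul_eq_mul, ← Finset.mul_sum]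
  rw [hfiber, Fin.sum_univ_add, mul_add]

lemma exchange_le {N' m : ℕ} {k b p q δ : ℝ≥0} (hpq : p + q = 1) (hkp : k * p ≤ b)
    (hp : ((N' + m : ℕ) : ℝ≥0) * p = N' * δ) {A A' B c w h : ℝ≥0∞} (hA : A ≤ A' + δ * w)
    (hA' : c ≤ A') (hB : m * c ≤ B) (hcw : (k * p : ℝ≥0) * (c + w) ≤ b * c + h) :
    k * (N' * A + B) ≤ (b + k * q : ℝ≥0) * (N' * A' + B) + (N' + m : ℕ) * h := by
  obtain ⟨r, hr⟩ : ∃ r, N' * A' + B = (N' + m : ℕ) * c + r := by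
    refine exists_add_of_le ?_
    push_cast
    rw [add_mul]
    gcongr
  have hk : (k : ℝ≥0∞) = (k * p : ℝ≥0) + (k * q : ℝ≥0) := by
    rw [← ENNReal.coe_add, ← mul_add, hpq, mul_one]
  have hp' : ((N' + m : ℕ) : ℝ≥0∞) * p = N' * δ := by exact_mod_cast hp
  calc k * (N' * A + B)
      ≤ k * (N' * (A' + δ * w) + B) := by gcongr
    _ = k * (N' * A' + B) + k * (N' * δ) * w := by ring
    _ = (k * p : ℝ≥0) * (N' * A' + B) + (k * q : ℝ≥0) * (N' * A' + B)
        + (k * p : ℝ≥0) * (N' + m : ℕ) * w := by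
        rw [← hp', ← add_mul, ← hk, ENNReal.coe_mul]; ring
    _ = (N' + m : ℕ) * ((k * p : ℝ≥0) * (c + w)) + (k * p : ℝ≥0) * r
        + (k * q : ℝ≥0) * (N' * A' + B) := by rw [hr]; ring
    _ ≤ (N' + m : ℕ) * (b * c + h) + b * r + (k * q : ℝ≥0) * (N' * A' + B) := by gcongr
    _ = b * ((N' + m : ℕ) * c + r) + (k * q : ℝ≥0) * (N' * A' + B) + (N' + m : ℕ) * h := by ring
    _ = (b + k * q : ℝ≥0) * (N' * A' + B) + (N' + m : ℕ) * h := by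
        rw [← hr, ENNReal.coe_add]; ring

lemma mul_iSup_le_mul_iInf_add {ι : Type*} [Nonempty ι] {a b : ℝ≥0} {h : ℝ≥0∞} {f : ι → ℝ≥0∞}
    (H : ∀ i j, a * f i ≤ b * f j + h) : a * ⨆ i, f i ≤ b * (⨅ j, f j) + h := by
  rw [ENNReal.mul_iSup, ENNReal.mul_iInf fun hb => absurd hb ENNReal.coe_ne_top, ENNReal.iInf_add]
  exact iSup_le fun i => le_iInf fun j => H i j

variable {N' m : ℕ} {k b p q δ : ℝ≥0} {h : ℝ≥0∞} {Ψ : (Fin N' → X) → ℝ≥0∞}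

lemma exchange_lintegral_le (hpq : p + q = 1) (hkp : k * p ≤ b)
    (hp : ((N' + m : ℕ) : ℝ≥0) * p = N' * δ) (hΨ : ∀ c, Ψ c ≤ 1)
    (hadj : ∀ c i y y', (k * p : ℝ≥0) * Ψ (Function.update c i y) ≤
      b * Ψ (Function.update c i y') + h)
    {P P' : Measure X} [IsProbabilityMeasure P] [IsProbabilityMeasure P']
    (H : TestBound 1 1 δ P P') (c : Fin N' → X) (j : Fin N') (y : Fin m → X) :
    k * (N' * ∫⁻ z, Ψ (Function.update c j z) ∂P + ∑ l, Ψ (Function.update c j (y l))) ≤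
      (b + k * q : ℝ≥0) *
        (N' * ∫⁻ z, Ψ (Function.update c j z) ∂P' + ∑ l, Ψ (Function.update c j (y l))) +
      (N' + m : ℕ) * h := by
  have : Nonempty X := nonempty_of_isProbabilityMeasure P
  set φ : X → ℝ≥0∞ := fun z => Ψ (Function.update c j z)
  have hsup : ⨆ z, φ z ≠ ∞ := ne_top_of_le_ne_top ENNReal.one_ne_top (iSup_le fun _ => hΨ _)
  have hosc : (⨅ z, φ z) + ((⨆ z, φ z) - ⨅ z, φ z) = ⨆ z, φ z :=
    add_tsub_cancel_of_le iInf_le_iSup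
  refine exchange_le hpq hkp hp (c := ⨅ z, φ z) (w := (⨆ z, φ z) - ⨅ z, φ z) ?_ ?_ ?_ ?_
  · exact H.lintegral_le (ne_top_of_le_ne_top hsup iInf_le_iSup)
      (ne_top_of_le_ne_top hsup tsub_le_self) (iInf_le φ) fun z => hosc.symm ▸ le_iSup φ z
  · simpa using lintegral_mono (μ := P') (iInf_le φ)
  · simpa using Finset.sum_le_sum fun l (_ : l ∈ Finset.univ) => iInf_le φ (y l)
  · rw [hosc]
    exact mul_iSup_le_mul_iInf_add (hadj c j)

lemma sum_perm_lintegral_update_le (hpq : p + q = 1) (hkp : k * p ≤ b)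
    (hp : ((N' + m : ℕ) : ℝ≥0) * p = N' * δ) (hΨ : ∀ c, Ψ c ≤ 1)
    (hadj : ∀ c i y y', (k * p : ℝ≥0) * Ψ (Function.update c i y) ≤
      b * Ψ (Function.update c i y') + h)
    {P P' : Measure X} [IsProbabilityMeasure P] [IsProbabilityMeasure P']
    (H : TestBound 1 1 δ P P') (n : Fin (N' + m)) (c : Fin (N' + m) → X) :
    k * ∑ π : Perm (Fin (N' + m)),
        ∫⁻ y, Ψ (fun i => Function.update c n y (π (Fin.castAdd m i))) ∂P ≤
      ∑ π : Perm (Fin (N' + m)), ((b + k * q : ℝ≥0) *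
        ∫⁻ y, Ψ (fun i => Function.update c n y (π (Fin.castAdd m i))) ∂P' + h) := by
  rcases N'.eq_zero_or_pos with rfl | hN'
  · have hk : k ≤ b + k * q := by
      calc k = k * p + k * q := by rw [← mul_add, hpq, mul_one]
        _ ≤ b + k * q := by gcongr
    rw [Finset.mul_sum]
    gcongr with π
    simp only [Subsingleton.elim (fun i => Function.update c n _ (π (Fin.castAdd m i))) Fin.elim0,
      lintegral_const, measure_univ, mul_one]
    exact le_add_right (by gcongr)
  have hN'0 : (N' : ℝ≥0∞) ≠ 0 := by exact_mod_cast hN'.ne'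
  refine (ENNReal.mul_le_mul_iff_right hN'0 (ENNReal.natCast_ne_top N')).mp ?_
  rw [mul_left_comm, sum_perm_exchange n, sum_perm_exchange n, Finset.mul_sum]
  refine Finset.sum_le_sum fun j _ => ?_
  rw [Finset.mul_sum]
  refine Finset.sum_le_sum fun π hπ => ?_
  replace hπ := (Finset.mem_filter.mp hπ).2
  simp only [update_comp_perm_of_mem hπ, update_comp_perm_of_exchanged hπ, lintegral_const,
    measure_univ, mul_one]
  refine (exchange_lintegral_le hpq hkp hp hΨ hadj H _ j _).trans_eq ?_
  simp only [Finset.sum_add_distrib, Finset.sum_const, Finset.card_univ, Fintype.card_fin,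
    nsmul_eq_mul, ← Finset.mul_sum]
  push_cast
  ring

lemma lintegral_batchLaw_le {N : ℕ} (hN : N' ≤ N) (hpq : p + q = 1) (hkp : k * p ≤ b)
    (hp : (N : ℝ≥0) * p = N' * δ) (hΨm : Measurable Ψ) (hΨ : ∀ c, Ψ c ≤ 1)
    (hadj : ∀ c i y y', (k * p : ℝ≥0) * Ψ (Function.update c i y) ≤
      b * Ψ (Function.update c i y') + h)
    {ν ν' : Fin N → Measure X} [∀ i, IsProbabilityMeasure (ν i)] [∀ i, IsProbabilityMeasure (ν' i)]
    (n : Fin N) (H : TestBound 1 1 δ (ν n) (ν' n)) (hne : ∀ i, i ≠ n → ν i = ν' i) :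
    k * ∫⁻ c, Ψ c ∂batchLaw hN ν ≤ (b + k * q : ℝ≥0) * ∫⁻ c, Ψ c ∂batchLaw hN ν' + h := by
  obtain ⟨m, rfl⟩ := Nat.exists_eq_add_of_le hN
  set M : ℝ≥0∞ := (Fintype.card (Perm (Fin (N' + m))) : ℝ≥0∞)
  have hM : M⁻¹ * M = 1 := ENNReal.inv_mul_cancel (by simp [M]) (by simp [M])
  let G (P : Measure X) (c : Fin (N' + m) → X) (π : Perm (Fin (N' + m))) : ℝ≥0∞ :=
    ∫⁻ y, Ψ (fun i => Function.update c n y (π (Fin.castAdd m i))) ∂P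
  have hG (P : Measure X) [IsProbabilityMeasure P] (π) : Measurable fun c => G P c π :=
    Measurable.lintegral_prod_left' (f := fun z : X × (Fin (N' + m) → X) =>
      Ψ fun i => Function.update z.2 n z.1 (π (Fin.castAdd m i))) (by fun_prop)
  have hbatch {μ : Fin (N' + m) → Measure X} [∀ i, IsProbabilityMeasure (μ i)]
      (hμ : ∀ i, i ≠ n → ν i = μ i) :
      ∫⁻ c, Ψ c ∂batchLaw hN μ = M⁻¹ * ∑ π, ∫⁻ c, G (μ n) c π ∂Measure.pi ν := by
    rw [batchLaw, lintegral_uniformMixture]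
    congr! 2 with π
    exact lintegral_pi_comp_eq_lintegral_update n hμ
      (π.injective.comp (Fin.castAdd_injective N' m)) hΨm
  calc k * ∫⁻ c, Ψ c ∂batchLaw hN ν
      = M⁻¹ * ∫⁻ c, k * ∑ π, G (ν n) c π ∂Measure.pi ν := by
        rw [hbatch fun _ _ => rfl,
          lintegral_const_mul _ (Finset.measurable_sum _ fun π _ => hG _ π),
          lintegral_finsetSum _ fun π _ => hG _ π, mul_left_comm]
    _ ≤ M⁻¹ * ∫⁻ c, ∑ π, ((b + k * q : ℝ≥0) * G (ν' n) c π + h) ∂Measure.pi ν := by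
        gcongr with c
        exact sum_perm_lintegral_update_le hpq hkp hp hΨ hadj H n c
    _ = (b + k * q : ℝ≥0) * ∫⁻ c, Ψ c ∂batchLaw hN ν' + M⁻¹ * M * h := by
        simp_rw [hbatch hne, Finset.sum_add_distrib, ← Finset.mul_sum]
        rw [lintegral_add_right _ measurable_const,
          lintegral_const_mul _ (Finset.measurable_sum _ fun π _ => hG _ π),
          lintegral_finsetSum _ fun π _ => hG _ π]
        simp only [Finset.sum_const, Finset.card_univ, nsmul_eq_mul, lintegral_const, measure_univ,
          mul_one, M]
        ring
    _ = (b + k * q : ℝ≥0) * ∫⁻ c, Ψ c ∂batchLaw hN ν' + h := by rw [hM, one_mul]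

instance {N N' : ℕ} (hN : N' ≤ N) (ν : Fin N → Measure X) [∀ i, IsProbabilityMeasure (ν i)] :
    IsProbabilityMeasure (batchLaw hN ν) := by
  unfold batchLaw; infer_instance

lemma TestBound.subsample {N N' : ℕ} (hN : N' ≤ N) (hpq : p + q = 1) (hkp : k * p ≤ b)
    (hp : (N : ℝ≥0) * p = N' * δ) {Z E : Type*} [MeasurableSpace Z] [MeasurableSpace E]
    {F : (Fin N' → X) × Z → E} (hF : Measurable F) (ζ : Measure Z) [IsProbabilityMeasure ζ]
    (hadj : ∀ c i y y', TestBound (k * p) b h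
      (ζ.map fun z => F (Function.update c i y, z)) (ζ.map fun z => F (Function.update c i y', z)))
    {ν ν' : Fin N → Measure X} [∀ i, IsProbabilityMeasure (ν i)] [∀ i, IsProbabilityMeasure (ν' i)]
    (n : Fin N) (H : TestBound 1 1 δ (ν n) (ν' n)) (hne : ∀ i, i ≠ n → ν i = ν' i) :
    TestBound k (b + k * q) h (((batchLaw hN ν).prod ζ).map F) (((batchLaw hN ν').prod ζ).map F) :=
  fun S hS => by
  rw [Measure.map_apply hF hS, Measure.map_apply hF hS, Measure.prod_apply (hF hS),
    Measure.prod_apply (hF hS)]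
  refine lintegral_batchLaw_le hN hpq hkp hp (measurable_measure_prodMk_left (hF hS))
    (fun _ => prob_le_one) (fun c i y y' => ?_) n H hne
  have hmap (c : Fin N' → X) : ζ (Prod.mk c ⁻¹' (F ⁻¹' S)) = ζ.map (fun z => F (c, z)) S := by
    rw [Measure.map_apply (by fun_prop) hS]; rfl
  rw [hmap, hmap]
  exact hadj c i y y' S hS

end Sampling

/-! ### Perturbed subsequences -/

section Subsequence

variable {L LC LF : ℕ}

/-- The law of the perturbed context and forecast windows of the subsequence `y`; `sC` and `sF` are
the standard deviations of the noise, written `σC * v` and `σF * v` in `stepLaw`. -/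
noncomputable def windowLaw (sC sF : ℝ) (y : Fin (LC + LF) → ℝ) :
    Measure ((Fin LC → ℝ) × (Fin LF → ℝ)) :=
  (Measure.pi fun i => normal (contextWindow y i) sC).prod
    (Measure.pi fun i => normal (forecastWindow y i) sF)

instance (sC sF : ℝ) (y : Fin (LC + LF) → ℝ) : IsProbabilityMeasure (windowLaw sC sF y) := by
  unfold windowLaw; infer_instance

/-- The law of the perturbed windows of a uniformly random subsequence of the series `a`. -/
noncomputable def subsequenceLaw (LC LF : ℕ) (sC sF : ℝ) (a : Fin L → ℝ) :
    Measure ((Fin LC → ℝ) × (Fin LF → ℝ)) :=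
  uniformMixture fun t => windowLaw sC sF (subsequence LC LF a t)

lemma isProbabilityMeasure_subsequenceLaw (hL : LF ≤ L) (sC sF : ℝ) (a : Fin L → ℝ) :
    IsProbabilityMeasure (subsequenceLaw LC LF sC sF a) := by
  have : Nonempty (Fin (L + 1 - LF)) := ⟨⟨0, by omega⟩⟩
  unfold subsequenceLaw; infer_instance

lemma testBound_windowLaw {k c : ℝ≥0} {τC τF : ℝ≥0∞} {sC sF : ℝ} {y y' : Fin (LC + LF) → ℝ}
    (u : Fin (LC + LF)) (hne : ∀ i, i ≠ u → y i = y' i)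
    (hC : TestBound k c τC (normal (y u) sC) (normal (y' u) sC))
    (hF : TestBound k c τF (normal (y u) sF) (normal (y' u) sF)) :
    TestBound k c (Fin.append (fun _ => τC) (fun _ => τF) u)
      (windowLaw sC sF y) (windowLaw sC sF y') := by
  cases u using Fin.addCases with
  | left i =>
    have hfore : forecastWindow y = forecastWindow y' := funext fun j => hne _ <| by
      simp only [ne_eq, Fin.ext_iff, Fin.val_natAdd, Fin.val_castAdd]; omega
    rw [Fin.append_left, windowLaw, windowLaw, hfore]
    exact (TestBound.pi i hC fun j hj =>
      congrArg (normal · sC) (hne _ ((Fin.castAdd_injective LC LF).ne hj))).prod_right _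
  | right i =>
    have hcont : contextWindow y = contextWindow y' := funext fun j => hne _ <| by
      simp only [ne_eq, Fin.ext_iff, Fin.val_natAdd, Fin.val_castAdd]; omega
    rw [Fin.append_right, windowLaw, windowLaw, hcont]
    exact (TestBound.pi i hF fun j hj =>
      congrArg (normal · sF) (hne _ ((Fin.natAdd_injective LF LC).ne hj))).prod_left _

lemma append_zero_eq_of_ne {a a' : Fin L → ℝ} {u : Fin L} (hne : ∀ i, i ≠ u → a i = a' i)
    {j : Fin (LC + L)} (hj : j ≠ Fin.natAdd LC u) :
    Fin.append (0 : Fin LC → ℝ) a j = Fin.append (0 : Fin LC → ℝ) a' j := by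
  cases j using Fin.addCases with
  | left i => simp only [Fin.append_left]
  | right i =>
    simp only [Fin.append_right]
    exact hne i (ne_of_apply_ne _ hj)

lemma testBound_windowLaw_subsequence {τC τF : ℝ≥0∞} {sC sF : ℝ} {a a' : Fin L → ℝ} (u : Fin L)
    (hne : ∀ i, i ≠ u → a i = a' i)
    (hC : TestBound 1 1 τC (normal (a u) sC) (normal (a' u) sC))
    (hF : TestBound 1 1 τF (normal (a u) sF) (normal (a' u) sF)) (t : Fin (L + 1 - LF)) :
    TestBound 1 1 (∑ i : Fin (LC + LF),
        if (t + i : ℕ) = LC + u then Fin.append (fun _ => τC) (fun _ => τF) i else 0)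
      (windowLaw sC sF (subsequence LC LF a t)) (windowLaw sC sF (subsequence LC LF a' t)) := by
  have heq {i : Fin (LC + LF)} (hi : (t + i : ℕ) ≠ LC + u) :
      subsequence LC LF a t i = subsequence LC LF a' t i :=
    append_zero_eq_of_ne hne fun h => hi (congrArg Fin.val h)
  by_cases hu : ∃ i : Fin (LC + LF), (t + i : ℕ) = LC + u
  · obtain ⟨i, hi⟩ := hu
    have hval (a : Fin L → ℝ) : subsequence LC LF a t i = a u := by
      rw [← Fin.append_right (0 : Fin LC → ℝ) a u]
      exact congrArg (Fin.append 0 a) (Fin.ext hi)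
    have hothers (j : Fin (LC + LF)) (hj : j ≠ i) : (t + j : ℕ) ≠ LC + u := fun h =>
      hj (Fin.ext (by omega))
    rw [Finset.sum_eq_single i (fun j _ hj => if_neg (hothers j hj)) (by simp), if_pos hi]
    exact testBound_windowLaw i (fun j hj => heq (hothers j hj)) (by simpa only [hval])
      (by simpa only [hval])
  · rw [show subsequence LC LF a t = subsequence LC LF a' t from
      funext fun i => heq (not_exists.mp hu i)]
    exact .refl le_rfl _ _

lemma testBound_subsequenceLaw {τC τF : ℝ≥0∞} {sC sF : ℝ} {a a' : Fin L → ℝ} (u : Fin L)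
    (hne : ∀ i, i ≠ u → a i = a' i)
    (hC : TestBound 1 1 τC (normal (a u) sC) (normal (a' u) sC))
    (hF : TestBound 1 1 τF (normal (a u) sF) (normal (a' u) sF)) :
    TestBound 1 1 (((L + 1 - LF : ℕ) : ℝ≥0∞)⁻¹ * (LC * τC + LF * τF))
      (subsequenceLaw LC LF sC sF a) (subsequenceLaw LC LF sC sF a') := by
  refine (TestBound.uniformMixture
    (testBound_windowLaw_subsequence u hne hC hF)).mono ?_
  rw [Fintype.card_fin, Finset.sum_comm]
  gcongr
  calc ∑ i : Fin (LC + LF), ∑ t : Fin (L + 1 - LF),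
        (if (t + i : ℕ) = LC + u then Fin.append (fun _ => τC) (fun _ => τF) i else 0)
      ≤ ∑ i : Fin (LC + LF), Fin.append (fun _ => τC) (fun _ => τF) i := by
        gcongr with i
        rw [← Finset.sum_filter, Finset.sum_const]
        refine (nsmul_le_nsmul_left zero_le ?_).trans_eq (one_nsmul _)
        refine Finset.card_le_one.mpr fun s hs t ht => Fin.ext ?_
        have := (Finset.mem_filter.mp hs).2
        have := (Finset.mem_filter.mp ht).2
        omega
    _ = LC * τC + LF * τF := by
        simp only [Fin.sum_univ_add, Fin.append_left, Fin.append_right, Finset.sum_const,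
          Finset.card_univ, Fintype.card_fin, nsmul_eq_mul]

lemma testBound_normal_of_abs_sub_le {s x x' v : ℝ} (hx : |x - x'| ≤ v) :
    TestBound 1 1 (ENNReal.ofReal (tvd (normal 0 s) (normal 1 s)))
      (normal x (s * v)) (normal x' (s * v)) := by
  simpa [mul_comm s] using (testBound_tvd_swap (normal 0 s) (normal 1 s)).normal_contract hx x'

end Subsequence

/-! ### The output distribution -/

section Step

lemma measurePreserving_pair {ι X Y : Type*} [Fintype ι] [MeasurableSpace X] [MeasurableSpace Y]
    (μ : ι → Measure X) (ν : ι → Measure Y) [∀ i, SigmaFinite (μ i)] [∀ i, SigmaFinite (ν i)] :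
    MeasurePreserving (fun z i => (z.1 i, z.2 i)) ((Measure.pi μ).prod (Measure.pi ν))
      (Measure.pi fun i => (μ i).prod (ν i)) :=
  (measurePreserving_arrowProdEquivProdArrow X Y ι μ ν).symm

lemma measurePreserving_const_add_normal (m s : ℝ) :
    MeasurePreserving (m + ·) (normal 0 s) (normal m s) :=
  ⟨measurable_const_add m, by rw [normal_map_const_add, add_zero]⟩

lemma measurePreserving_add_noise {LC LF : ℕ} {ι κ : Type*} [Fintype ι] [Fintype κ] (sC sF : ℝ)
    (y : ι → κ → Fin (LC + LF) → ℝ) :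
    MeasurePreserving
      (fun z : (ι → κ → Fin LC → ℝ) × (ι → κ → Fin LF → ℝ) => fun i j =>
        (contextWindow (y i j) + z.1 i j, forecastWindow (y i j) + z.2 i j))
      ((Measure.pi fun _ => Measure.pi fun _ => Measure.pi fun _ => normal 0 sC).prod
        (Measure.pi fun _ => Measure.pi fun _ => Measure.pi fun _ => normal 0 sF))
      (Measure.pi fun i => Measure.pi fun j => windowLaw sC sF (y i j)) := by
  have hshift {τ : Type} [Fintype τ] (m : ι → κ → τ → ℝ) (s : ℝ) :
      MeasurePreserving (fun z i j l => m i j l + z i j l)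
        (Measure.pi fun _ => Measure.pi fun _ => Measure.pi fun _ => normal 0 s)
        (Measure.pi fun i => Measure.pi fun j => Measure.pi fun l => normal (m i j l) s) :=
    measurePreserving_pi _ _ fun i => measurePreserving_pi _ _ fun j =>
      measurePreserving_pi _ _ fun l => measurePreserving_const_add_normal (m i j l) s
  exact (measurePreserving_pi _ _ fun i => measurePreserving_pair _ _).comp
    ((measurePreserving_pair _ _).comp ((hshift (fun i j => contextWindow (y i j)) sC).prod
      (hshift (fun i j => forecastWindow (y i j)) sF)))

variable {L LC LF D N : ℕ}

/-- The updated weights as a function of the perturbed windows `q.1` and the noise `q.2` added to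
the sum of the clipped gradients; `G` maps a window to its clipped gradient. -/
noncomputable def windowStep {N' lam : ℕ} (Λ : ℕ)
    (G : (Fin LC → ℝ) × (Fin LF → ℝ) → EuclideanSpace ℝ (Fin D))
    (θ : EuclideanSpace ℝ (Fin D)) (η : ℝ)
    (q : (Fin N' → Fin lam → (Fin LC → ℝ) × (Fin LF → ℝ)) × (Fin D → ℝ)) :
    EuclideanSpace ℝ (Fin D) :=
  θ - η • ((1 / (Λ : ℝ)) • ((∑ n, ∑ j, G (q.1 n j)) + WithLp.toLp 2 q.2))

lemma measurable_windowStep {N' lam : ℕ} (Λ : ℕ)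
    {G : (Fin LC → ℝ) × (Fin LF → ℝ) → EuclideanSpace ℝ (Fin D)} (hG : Measurable G)
    (θ : EuclideanSpace ℝ (Fin D)) (η : ℝ) :
    Measurable (windowStep (N' := N') (lam := lam) Λ G θ η) := by
  unfold windowStep
  fun_prop

lemma stepLaw_eq {O : Type*} (lam Λ : ℕ) (hN : Λ / lam ≤ N) (hL : LF ≤ L)
    (f : EuclideanSpace ℝ (Fin D) → (Fin LC → ℝ) → O) (ℓ : O → (Fin LF → ℝ) → ℝ)
    (θ : EuclideanSpace ℝ (Fin D)) (η σ C σC σF v : ℝ)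
    (hG : Measurable fun w : (Fin LC → ℝ) × (Fin LF → ℝ) => clip C (lossGradient f ℓ θ w.1 w.2))
    (x : Fin N → Fin L → ℝ) :
    stepLaw lam Λ hN f ℓ θ η σ C σC σF v x =
      ((batchLaw hN fun n =>
          Measure.pi fun _ : Fin lam => subsequenceLaw LC LF (σC * v) (σF * v) (x n)).prod
        (Measure.pi fun _ => normal 0 (σ * C))).map
          (windowStep Λ (fun w => clip C (lossGradient f ℓ θ w.1 w.2)) θ η) := by
  have : Nonempty (Fin (L + 1 - LF)) := ⟨⟨0, by omega⟩⟩
  simp only [batchLaw, subsequenceLaw]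
  simp_rw [pi_uniformMixture, uniformMixture_prod]
  rw [uniformMixture_map _ (measurable_windowStep Λ hG θ η), stepLaw, uniformMixture_fst_snd]
  congr! 2 with π
  rw [uniformMixture_map _ (measurable_windowStep Λ hG θ η)]
  congr! 2 with t
  have hnoise := ((measurePreserving_add_noise (σC * v) (σF * v) fun i j =>
      subsequence LC LF (x (π (Fin.castLE hN i))) (t i j)).prod
    (MeasurePreserving.id (Measure.pi fun _ : Fin D => normal 0 (σ * C)))).comp
      (measurePreserving_prodAssoc _ _ _).symm
  rw [← hnoise.map_eq, Measure.map_map (measurable_windowStep Λ hG θ η) hnoise.measurable]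
  rfl

end Step

/-! ### The privacy profile -/

section Profile

variable {L LC LF D N : ℕ}

lemma measurable_clip (C : ℝ) : Measurable (clip (D := D) C) := by
  unfold clip
  fun_prop

lemma norm_clip_le {C : ℝ} (hC : 0 < C) (g : EuclideanSpace ℝ (Fin D)) : ‖clip C g‖ ≤ C := by
  have hmax : 0 < max 1 (‖g‖ / C) := lt_max_of_lt_left one_pos
  rw [clip, norm_smul, norm_inv, Real.norm_of_nonneg hmax.le, inv_mul_le_iff₀ hmax,
    ← div_le_iff₀ hC]
  exact le_max_right _ _

lemma EventNeighbor.symm {w : ℕ} {v : ℝ} {x x' : Fin N → Fin L → ℝ}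
    (hx : EventNeighbor w v x x') : EventNeighbor w v x' x := by
  obtain ⟨n, hne, ⟨t, ht⟩, hv⟩ := hx
  exact ⟨n, fun m hm => (hne m hm).symm, ⟨t, fun s hs => ht s hs.symm⟩,
    fun s => abs_sub_comm (x n s) _ ▸ hv s⟩

lemma EventNeighbor.eq_or_exists_forall_ne {v : ℝ} {x x' : Fin N → Fin L → ℝ}
    (hx : EventNeighbor 1 v x x') :
    x = x' ∨ ∃ n u, (∀ m, m ≠ n → x m = x' m) ∧ (∀ s, s ≠ u → x n s = x' n s) ∧
      |x n u - x' n u| ≤ v := by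
  obtain ⟨n, hne, ⟨t, ht⟩, hv⟩ := hx
  by_cases hu : ∃ u, x n u ≠ x' n u
  · obtain ⟨u, hu⟩ := hu
    refine .inr ⟨n, u, hne, fun s hs => of_not_not fun hs' => hs (Fin.ext ?_), hv u⟩
    have := ht u hu
    have := ht s hs'
    omega
  · refine .inl (funext fun m => ?_)
    rcases eq_or_ne m n with rfl | hm
    · exact funext fun s => of_not_not (not_exists.mp hu s)
    · exact hne m hm

lemma mog_pair_eq (m m' p s : ℝ) : mog ![m, m'] ![1 - p, p] s =
    ENNReal.ofReal (1 - p) • normal m s + ENNReal.ofReal p • normal m' s := by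
  simp [mog, Fin.sum_univ_two]

lemma isProbabilityMeasure_mog_pair {p : ℝ} (hp0 : 0 ≤ p) (hp1 : p ≤ 1) (m m' s : ℝ) :
    IsProbabilityMeasure (mog ![m, m'] ![1 - p, p] s) :=
  ⟨by simp [mog_pair_eq, ← ENNReal.ofReal_add (sub_nonneg.mpr hp1) hp0]⟩

/-- The bound on the total variation distance between the perturbed subsequences of two series that
differ by at most `v` in a single entry: a given entry lies in the context window of at most `LC`,
and in the forecast window of at most `LF`, of the `L - LF + 1` subsequences. -/
noncomputable def subsequenceTVD (L LC LF : ℕ) (σC σF : ℝ) : ℝ :=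
  (LC * tvd (normal 0 σC) (normal 1 σC) + LF * tvd (normal 0 σF) (normal 1 σF)) /
    ((L : ℝ) - LF + 1)

lemma subsequenceTVD_self (L LC LF : ℕ) (s : ℝ) :
    subsequenceTVD L LC LF s s =
      ((LC : ℝ) + LF) / ((L : ℝ) - LF + 1) * tvd (normal 0 s) (normal 1 s) := by
  rw [subsequenceTVD, ← add_mul, div_mul_eq_mul_div]

lemma subsequenceTVD_nonneg (hL : LF ≤ L) (σC σF : ℝ) : 0 ≤ subsequenceTVD L LC LF σC σF := by
  have hLF : (LF : ℝ) ≤ L := Nat.cast_le.mpr hL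
  refine div_nonneg ?_ (by linarith)
  have := tvd_nonneg (normal 0 σC) (normal 1 σC)
  have := tvd_nonneg (normal 0 σF) (normal 1 σF)
  positivity

lemma subsequenceTVD_le_one (hL : LC + LF ≤ L + 1 - LF) (σC σF : ℝ) :
    subsequenceTVD L LC LF σC σF ≤ 1 := by
  have hL' : LC + LF + LF ≤ L + 1 := by omega
  have hcast : (LC + LF + LF : ℝ) ≤ L + 1 := by exact_mod_cast hL'
  refine div_le_one_of_le₀ ?_ (by linarith [LC.cast_nonneg (α := ℝ), LF.cast_nonneg (α := ℝ)])
  calc LC * tvd (normal 0 σC) (normal 1 σC) + LF * tvd (normal 0 σF) (normal 1 σF)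
      ≤ LC * 1 + LF * 1 := by gcongr <;> exact tvd_le_one _ _
    _ ≤ (L : ℝ) - LF + 1 := by linarith

lemma ofReal_subsequenceTVD (hL : LF ≤ L) (σC σF : ℝ) :
    ENNReal.ofReal (subsequenceTVD L LC LF σC σF) =
      ((L + 1 - LF : ℕ) : ℝ≥0∞)⁻¹ * (LC * ENNReal.ofReal (tvd (normal 0 σC) (normal 1 σC)) +
        LF * ENNReal.ofReal (tvd (normal 0 σF) (normal 1 σF))) := by
  have hsub : (L : ℝ) - LF + 1 = (L + 1 - LF : ℕ) := by
    rw [Nat.cast_sub (by omega)]; push_cast; ring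
  have hpos : 0 < ((L + 1 - LF : ℕ) : ℝ) := Nat.cast_pos.mpr (by omega)
  have hC := tvd_nonneg (normal 0 σC) (normal 1 σC)
  have hF := tvd_nonneg (normal 0 σF) (normal 1 σF)
  rw [subsequenceTVD, hsub, ENNReal.ofReal_div_of_pos hpos,
    ENNReal.ofReal_add (by positivity) (by positivity), ENNReal.ofReal_mul (by positivity),
    ENNReal.ofReal_mul (by positivity), ENNReal.ofReal_natCast, ENNReal.ofReal_natCast,
    ENNReal.ofReal_natCast, ENNReal.div_eq_inv_mul]

lemma testBound_subsequenceLaw_of_abs_sub_le (hL : LF ≤ L) (σC σF : ℝ) {v : ℝ} {a a' : Fin L → ℝ}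
    (u : Fin L) (hne : ∀ i, i ≠ u → a i = a' i) (hu : |a u - a' u| ≤ v) :
    TestBound 1 1 (ENNReal.ofReal (subsequenceTVD L LC LF σC σF))
      (subsequenceLaw LC LF (σC * v) (σF * v) a) (subsequenceLaw LC LF (σC * v) (σF * v) a') := by
  rw [ofReal_subsequenceTVD hL]
  exact testBound_subsequenceLaw u hne (testBound_normal_of_abs_sub_le hu)
    (testBound_normal_of_abs_sub_le hu)

lemma testBound_windowStep {N' Λ : ℕ} {k a : ℝ≥0} {h : ℝ≥0∞} {σ C : ℝ} (hka : k ≤ a)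
    (H : TestBound k a h (normal 2 σ) (normal 0 σ))
    {G : (Fin LC → ℝ) × (Fin LF → ℝ) → EuclideanSpace ℝ (Fin D)} (hGC : ∀ w, ‖G w‖ ≤ C)
    (θ : EuclideanSpace ℝ (Fin D)) (η : ℝ) (c : Fin N' → Fin 1 → (Fin LC → ℝ) × (Fin LF → ℝ))
    (i : Fin N') (y y' : Fin 1 → (Fin LC → ℝ) × (Fin LF → ℝ)) :
    TestBound k a h
      ((Measure.pi fun _ => normal 0 (σ * C)).map fun z =>
        windowStep Λ G θ η (Function.update c i y, z))
      ((Measure.pi fun _ => normal 0 (σ * C)).map fun z =>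
        windowStep Λ G θ η (Function.update c i y', z)) := by
  have hsum (y : Fin 1 → (Fin LC → ℝ) × (Fin LF → ℝ)) :
      ∑ n, ∑ j, G (Function.update c i y n j) =
        G (y 0) + ∑ n ∈ Finset.univ.erase i, ∑ j, G (c n j) := by
    rw [← Finset.add_sum_erase _ _ (Finset.mem_univ i), Function.update_self,
      Fin.sum_univ_one]
    congr 1
    exact Finset.sum_congr rfl fun n hn => by
      rw [Function.update_of_ne (Finset.ne_of_mem_erase hn)]
  have hdist : ‖∑ n, ∑ j, G (Function.update c i y n j) -
      ∑ n, ∑ j, G (Function.update c i y' n j)‖ ≤ C * 2 := by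
    rw [hsum, hsum, add_sub_add_right_eq_sub]
    linarith [norm_sub_le (G (y 0)) (G (y' 0)), hGC (y 0), hGC (y' 0)]
  have := (H.gaussian_of_norm_sub_le hka two_pos hdist).map
    (g := fun w => θ - η • ((1 / (Λ : ℝ)) • w)) (by fun_prop)
  rw [Measure.map_map (by fun_prop) (by fun_prop), Measure.map_map (by fun_prop) (by fun_prop),
    mul_comm C] at this
  exact this

variable {O : Type*} {lam Λ : ℕ} {f : EuclideanSpace ℝ (Fin D) → (Fin LC → ℝ) → O}
  {ℓ : O → (Fin LF → ℝ) → ℝ} {θ : EuclideanSpace ℝ (Fin D)}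

lemma isProbabilityMeasure_stepLaw (hL : LF ≤ L)
    (hmeas : Measurable fun q : (Fin LC → ℝ) × (Fin LF → ℝ) => lossGradient f ℓ θ q.1 q.2)
    (hN : Λ / lam ≤ N) (η σ C σC σF v : ℝ) (x : Fin N → Fin L → ℝ) :
    IsProbabilityMeasure (stepLaw lam Λ hN f ℓ θ η σ C σC σF v x) := by
  have := isProbabilityMeasure_subsequenceLaw (LC := LC) hL (σC * v) (σF * v)
  have hG := (measurable_clip C).comp hmeas
  rw [stepLaw_eq lam Λ hN hL f ℓ θ η σ C σC σF v hG]
  exact Measure.isProbabilityMeasure_map (measurable_windowStep Λ hG θ η).aemeasurable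

lemma testBound_stepLaw (hL : LF ≤ L)
    (hmeas : Measurable fun q : (Fin LC → ℝ) × (Fin LF → ℝ) => lossGradient f ℓ θ q.1 q.2)
    (hN : Λ / 1 ≤ N) {σ C σC σF v : ℝ} (η : ℝ) (hC : 0 < C) {k a : ℝ≥0} (hka : k ≤ a) {h : ℝ≥0∞}
    {p : ℝ} (hp0 : 0 ≤ p) (hp1 : p ≤ 1)
    (hp : N * p = (Λ / 1 : ℕ) * subsequenceTVD L LC LF σC σF)
    (H : TestBound k a h (mog ![0, 2] ![1 - p, p] σ) (normal 0 σ))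
    {x x' : Fin N → Fin L → ℝ} (hx : EventNeighbor 1 v x x') :
    TestBound k a h (stepLaw 1 Λ hN f ℓ θ η σ C σC σF v x)
      (stepLaw 1 Λ hN f ℓ θ η σ C σC σF v x') := by
  obtain rfl | ⟨n, u, hxn, hxu, hv⟩ := hx.eq_or_exists_forall_ne
  · exact .refl hka _ _
  have := isProbabilityMeasure_subsequenceLaw (LC := LC) hL (σC * v) (σF * v)
  have hG := (measurable_clip C).comp hmeas
  lift p to ℝ≥0 using hp0
  obtain ⟨q, hpq⟩ := exists_add_of_le (show p ≤ 1 from hp1)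
  have hk : k * p + k * q = k := by rw [← mul_add, ← hpq, mul_one]
  obtain ⟨b, rfl, hkp⟩ : ∃ b, a = b + k * q ∧ k * p ≤ b := by
    obtain ⟨c, rfl⟩ := exists_add_of_le hka
    exact ⟨c + k * p, by rw [add_assoc, hk, add_comm], le_add_self⟩
  have hp' : (N : ℝ≥0) * p = (Λ / 1 : ℕ) * (subsequenceTVD L LC LF σC σF).toNNReal := by
    ext
    simpa [subsequenceTVD_nonneg hL] using hp
  have hmix : TestBound (k * p) b h (normal 2 σ) (normal 0 σ) := by
    have hq : 1 - (p : ℝ) = q := sub_eq_of_eq_add' (by exact_mod_cast hpq)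
    rw [mog_pair_eq, hq, ENNReal.ofReal_coe_nnreal, ENNReal.ofReal_coe_nnreal] at H
    exact H.of_mixture
  have hsub := testBound_subsequenceLaw_of_abs_sub_le (LC := LC) hL σC σF u hxu hv
  rw [stepLaw_eq 1 Λ hN hL f ℓ θ η σ C σC σF v hG, stepLaw_eq 1 Λ hN hL f ℓ θ η σ C σC σF v hG]
  refine TestBound.subsample hN hpq.symm hkp hp' (measurable_windowStep Λ hG θ η) _
    (testBound_windowStep hkp hmix (fun _ => norm_clip_le hC _) θ η) n
    (TestBound.pi 0 hsub fun i hi => absurd (Subsingleton.elim i 0) hi) fun i hi => by rw [hxn i hi]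

end Profile

end DPForecast

theorem theorem4p5_general {L LC LF D N : ℕ} {O : Type*} (hL : LC + LF ≤ L + 1 - LF)
    (lam Λ : ℕ) (hlam : lam = 1) (hN : Λ / lam ≤ N)
    (f : EuclideanSpace ℝ (Fin D) → (Fin LC → ℝ) → O) (ℓ : O → (Fin LF → ℝ) → ℝ)
    (θ : EuclideanSpace ℝ (Fin D))
    (hmeas : Measurable fun q : (Fin LC → ℝ) × (Fin LF → ℝ) => lossGradient f ℓ θ q.1 q.2)
    (η σ C σC σF v : ℝ) (hC : 0 < C) :
    let ρ : ℝ := ((Λ / lam : ℕ) : ℝ) / N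
    let p₂ : ℝ := ρ * subsequenceTVD L LC LF σC σF
    let P : Measure ℝ := mog ![0, 2] ![1 - p₂, p₂] σ
    let Q : Measure ℝ := normal 0 σ
    let H : ℝ≥0 → ℝ≥0∞ := fun α =>
      ⨆ (x : Fin N → Fin L → ℝ) (x' : Fin N → Fin L → ℝ) (_ : EventNeighbor 1 v x x'),
        hockeyStick α (stepLaw lam Λ hN f ℓ θ η σ C σC σF v x)
          (stepLaw lam Λ hN f ℓ θ η σ C σC σF v x')
    (0 ≤ p₂ ∧ p₂ ≤ 1) ∧
      ∀ α : ℝ≥0,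
        (1 ≤ α → H α ≤ hockeyStick α P Q) ∧ (α < 1 → H α ≤ hockeyStick α Q P) := by
  subst hlam
  intro ρ p₂ P Q _
  have hLF : LF ≤ L := by omega
  have hρ0 : 0 ≤ ρ := by positivity
  have hρ1 : ρ ≤ 1 := div_le_one_of_le₀ (Nat.cast_le.mpr hN) N.cast_nonneg
  have hp0 : 0 ≤ p₂ := mul_nonneg hρ0 (subsequenceTVD_nonneg hLF σC σF)
  have hp1 : p₂ ≤ 1 :=
    mul_le_one₀ hρ1 (subsequenceTVD_nonneg hLF σC σF) (subsequenceTVD_le_one hL σC σF)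
  have := isProbabilityMeasure_mog_pair hp0 hp1 0 2 σ
  have := isProbabilityMeasure_stepLaw hLF hmeas hN η σ C σC σF v
  have hstep {k a : ℝ≥0} {h : ℝ≥0∞} (hka : k ≤ a) (HPQ : TestBound k a h P Q)
      {x x' : Fin N → Fin L → ℝ} (hx : EventNeighbor 1 v x x') :
      TestBound k a h (stepLaw 1 Λ hN f ℓ θ η σ C σC σF v x)
        (stepLaw 1 Λ hN f ℓ θ η σ C σC σF v x') := by
    have ⟨n, _⟩ := hx
    have hN0 : (N : ℝ) ≠ 0 := Nat.cast_ne_zero.mpr n.pos.ne'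
    refine testBound_stepLaw hLF hmeas hN η hC hka hp0 hp1 ?_ HPQ hx
    rw [← mul_assoc, mul_div_cancel₀ _ hN0]
  refine ⟨⟨hp0, hp1⟩, fun α => ⟨fun hα => ?_, fun hα => ?_⟩⟩ <;>
    refine iSup₂_le fun x x' => iSup_le fun hx => ?_
  · exact (hstep hα (testBound_hockeyStick α P Q) hx).hockeyStick_le
  · exact hockeyStick_le_of_testBound_imp fun _ hPQ => hstep hα.le hPQ hx.symm

theorem theorem4p5 {L LC LF D N : ℕ} {O : Type*}
    (hL : LC + LF ≤ L + 1 - LF)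
    (lam Λ : ℕ) (hlam : lam = 1) (hΛ : 1 ≤ Λ) (hN : Λ / lam ≤ N)
    (f : EuclideanSpace ℝ (Fin D) → (Fin LC → ℝ) → O) (ℓ : O → (Fin LF → ℝ) → ℝ)
    (θ : EuclideanSpace ℝ (Fin D))
    (hmeas : Measurable fun q : (Fin LC → ℝ) × (Fin LF → ℝ) => lossGradient f ℓ θ q.1 q.2)
    (η σ C σC σF v : ℝ) (hσ : 0 ≤ σ) (hC : 0 < C)
    (hσC : 0 ≤ σC) (hσF : 0 ≤ σF) (hCF : σC = σF) (hv : 0 ≤ v) :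
    let r : ℝ := ((LC : ℝ) + LF) / ((L : ℝ) - LF + 1)
    let ρ : ℝ := ((Λ / lam : ℕ) : ℝ) / N
    let p₂ : ℝ := ρ * r * tvd (normal 0 σF) (normal 1 σF)
    let P : Measure ℝ := mog ![0, 2] ![1 - p₂, p₂] σ
    let Q : Measure ℝ := normal 0 σ
    let H : ℝ≥0 → ℝ≥0∞ := fun α =>
      ⨆ (x : Fin N → Fin L → ℝ) (x' : Fin N → Fin L → ℝ) (_ : EventNeighbor 1 v x x'),
        hockeyStick α (stepLaw lam Λ hN f ℓ θ η σ C σC σF v x)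
          (stepLaw lam Λ hN f ℓ θ η σ C σC σF v x')
    (0 ≤ p₂ ∧ p₂ ≤ 1) ∧
      ∀ α : ℝ≥0,
        (1 ≤ α → H α ≤ hockeyStick α P Q) ∧ (α < 1 → H α ≤ hockeyStick α Q P) := by
  subst hCF
  simpa only [subsequenceTVD_self, mul_assoc] using
    theorem4p5_general hL lam Λ hlam hN f ℓ θ hmeas η σ C σC σC v hC
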